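/- For $x\in\mathbb{R}$ let $\log^*(x)$ be the number of times the natural logarithm must be iteratively applied, starting from $x$, before the result is at most $1$. A 1-bit mean estimator with $n$ samples works in $n$ rounds. In round $t$ the learner chooses, possibly at random and depending on the history $(Q_1,Y_1,\dots,Q_{t-1},Y_{t-1})$, a function $Q_t:\mathbb{R}\to\{0,1\}$, and receives the bit $Y_t=Q_t(X_t)$, where $X_1,\dots,X_n$ are i.i.d. with unknown distribution $D$. After $n$ rounds it outputs an estimate $\hat\mu\in\mathbb{R}$ that is a function of the transcript $(Q_1,Y_1,\dots,Q_n,Y_n)$. An interval query is a function $Q_t=\mathbf{1}\{\,\cdot\in[a,b]\}$, where $a=-\infty$ or $b=\infty$ is allowed. For $\lambda\ge\sigma>0$ let $\mathcal{D}$ be the family of all distributions $D$ on $\mathbb{R}$ with mean $\mu(D)\in[-\lambda,\lambda]$ for which $X-\mu(D)$, $X\sim D$, is sub-Gaussian with parameter $\sigma^2$, i.e. $\Pr(|X-\mu(D)|\ge t)\le 2\exp\left(-\frac{t^2}{2\sigma^2}\right)$ for all $t\ge 0$. **Theorem.** There is an absolute constant $C>0$ such that for all $0<\epsilon<\sigma\le\lambda$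 and $0<\delta<1$ there is a 1-bit mean estimator (which may depend on $\epsilon,\delta,\lambda,\sigma$, but not on $D$) that uses only interval queries, is $(\epsilon,\delta)$-PAC for $\mathcal{D}$, that is, $\Pr(|\hat\mu-\mu(D)|\le\epsilon)\ge 1-\delta$ for every $D\in\mathcal{D}$ (with probability over the samples and the internal randomness of the estimator), and uses $$n\le\left\lceil C\left(\frac{\sigma^2}{\epsilon^2}\cdot\left(\log^*\left(\frac{\sigma}{\epsilon}\right)\right)^3\cdot\log\left(\frac{\log^*(\sigma/\epsilon)}{\delta}\right)+\log\frac{\lambda}{\sigma}\right)\right\rceil$$ samples. -/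

import Mathlib

open MeasureTheory

/-- Iterating the natural logarithm from any real number reaches a value at most `1`. -/
theorem exists_iterate_log_le_one (x : ℝ) : ∃ k : ℕ, Real.log^[k] x ≤ 1 := by
  by_contra! h
  have hb : ∀ k : ℕ, Real.log^[k] x ≤ x - k := by
    intro k
    induction k with
    | zero => simp
    | succ k ih =>
      rw [Function.iterate_succ_apply']
      have h1 := Real.log_le_sub_one_of_pos (lt_trans one_pos (h k))
      push_cast
      linarith
  obtain ⟨k, hk⟩ := exists_nat_gt x
  linarith [hb k, h k]

/-- The iterated logarithm `log* x`: the number of times the natural logarithm has to be applied,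
starting from `x`, before the result is at most `1`. The set below is nonempty by
`exists_iterate_log_le_one`. -/
noncomputable def logStar (x : ℝ) : ℕ :=
  sInf {k : ℕ | Real.log^[k] x ≤ 1}

/-- A 1-bit quantization function `Q : ℝ → {0, 1}`. -/
abbrev Query : Type := ℝ → Bool

/-- The interaction history `(Q₁, Y₁, …, Q_t, Y_t)` after `t` rounds. -/
abbrev Transcript (t : ℕ) : Type := Fin t → Query × Bool

/-- `Q` is an interval query: it asks whether the sample lies in `[a, b]`, where `a = -∞` or
`b = ∞` is possible. -/
def Query.IsInterval (Q : Query) : Prop :=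
  ∃ a b : EReal, ∀ x : ℝ, Q x = true ↔ a ≤ (x : EReal) ∧ (x : EReal) ≤ b

/-- The history produced by `t` rounds of the 1-bit protocol. In each round the learner chooses
a quantization function from its internal randomness `s` and the history so far, and the agent
answers with the value of that function at the fresh sample of the round. -/
def runProtocol {S : Type} (query : (t : ℕ) → S → Transcript t → Query) (s : S) :
    (t : ℕ) → (Fin t → ℝ) → Transcript t
  | 0, _ => Fin.elim0
  | t + 1, x =>
    let h : Transcript t := runProtocol query s t (fun i => x i.castSucc)
    Fin.snoc (α := fun _ => Query × Bool) h (query t s h, query t s h (x (Fin.last t)))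

/-- A 1-bit mean estimator using `n` samples: a randomized, adaptive query strategy and a rule
that maps the full transcript to an estimate. The randomness is a seed drawn from `seedLaw`.
The 1-bit messages and the estimate are required to be random variables, as functions of the seed
and of the samples. -/
structure OneBitMeanEstimator (n : ℕ) where
  Seed : Type
  [measurableSpaceSeed : MeasurableSpace Seed]
  seedLaw : Measure Seed
  [isProbabilityMeasure_seedLaw : IsProbabilityMeasure seedLaw]
  query : (t : ℕ) → Seed → Transcript t → Query
  estimate : Transcript n → ℝ
  measurable_message : ∀ t : Fin n,
    Measurable fun p : Seed × (Fin n → ℝ) => (runProtocol query p.1 n p.2 t).2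
  measurable_estimate :
    Measurable fun p : Seed × (Fin n → ℝ) => estimate (runProtocol query p.1 n p.2)

attribute [instance] OneBitMeanEstimator.measurableSpaceSeed
  OneBitMeanEstimator.isProbabilityMeasure_seedLaw

namespace OneBitMeanEstimator

variable {n : ℕ}

/-- The estimate returned on the seed `p.1` and the samples `p.2`. -/
def output (A : OneBitMeanEstimator n) (p : A.Seed × (Fin n → ℝ)) : ℝ :=
  A.estimate (runProtocol A.query p.1 n p.2)

/-- The estimator only ever asks interval queries. -/
def UsesIntervalQueries (A : OneBitMeanEstimator n) : Prop :=
  ∀ (t : ℕ) (s : A.Seed) (h : Transcript t), (A.query t s h).IsInterval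

/-- `A` is `(ε, δ)`-PAC for the family `𝒟`: for each `D ∈ 𝒟`, the estimate is within `ε` of the
mean of `D` with probability at least `1 - δ`, over the `n` i.i.d. samples from `D` and the
independent internal randomness of `A`. -/
def IsPAC (A : OneBitMeanEstimator n) (ε δ : ℝ) (𝒟 : Set (Measure ℝ)) : Prop :=
  ∀ D ∈ 𝒟, ENNReal.ofReal (1 - δ) ≤
    (A.seedLaw.prod (Measure.pi fun _ : Fin n => D)) {p | |A.output p - ∫ x, x ∂D| ≤ ε}

end OneBitMeanEstimator

/-- The distributions on `ℝ` whose mean `μ` lies in `[-lam, lam]` and for which `X - μ` is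
sub-Gaussian with parameter `σ²`: `Pr(|X - μ| ≥ t) ≤ 2 exp (-t² / (2 σ²))` for all `t ≥ 0`. -/
def subGaussianFamily (lam σ : ℝ) : Set (Measure ℝ) :=
  {D | IsProbabilityMeasure D ∧ Integrable (fun x : ℝ => x) D ∧
    |∫ x, x ∂D| ≤ lam ∧
    ∀ t : ℝ, 0 ≤ t →
      D {x | t ≤ |x - ∫ y, y ∂D|} ≤ ENNReal.ofReal (2 * Real.exp (-t ^ 2 / (2 * σ ^ 2)))}

/-!
# One-bit mean estimation with interval queries

The estimator asks only queries of the form `X ≥ τ`, and `O(σ² / ε² · log (1 / δ) + log (λ / σ))`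
samples suffice once this quantity is bounded below. As `logStar (σ / ε) ≥ 1`, this is within the
stated budget, which has extra powers of `logStar`. Lengths are measured in units of `σ`; `a` is the
mean, and `L = 128 + log (λ / σ) + log (1 / δ)`.

*Search.* A centre `θ` is moved by `± ζ_t b_t` according to the answer to `X ≥ θ`, where the
deterministic radius shrinks by `b_{t+1} = b_t (1 - ζ_t / 2)` and `ζ = b² / (256 (L + b²))`. By the
sub-Gaussian tail, an answer at distance `b / 2` from the mean is wrong with probability at most
`2 exp (-b² / 8)`, which makes `exp (8 L (|θ - a| / b - 1))` a supermartingale up to a loss of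
`exp (-2 L)` per step (`lintegral_searchPotential_le`). The radius reaches the constant `16` within
`O(L)` steps (`exists_radius_le`), as `log b - L / (2 b²)` decreases by a constant in each.

*Averaging.* With a standard Cauchy variable `T` of density `p`, the learner asks `X ≥ θ + T`, and
`(1{X ≥ θ + T} - 1{T < 0}) / p(T)` has expectation `E X - θ`. Although unbounded, this weight is
sub-exponential when `|θ - a| ≤ 16`: it is of size `T²` only if `X` is `|T|` away from `θ`
(`lintegral_exp_rayWeight_le`). Hence a Chernoff bound applies to the sum of
`O(σ² / ε² · log (1 / δ))` weights.

Both phases form one state machine whose state is a function of the transcript, the random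
threshold being the end point of the query. One potential function covers both: its expectation does
not increase in any round (`lintegral_meanPotential_succ_le`), it is at least `1` on a wrong final
estimate and at most `δ` at the start, so that `ThresholdLearner.le_measure_output_toEstimator`
gives the accuracy.

The budget can be smaller than any constant, namely if `σ / ε ≤ e`, `λ` is close to `σ` and `δ` is
close to `1`. Then `[-λ, λ]` is covered by three intervals of length `2ε`, and a random guess
succeeds with probability `1 / 3 ≥ 1 - δ` (`exists_estimator_of_le`).
-/

/-! ### Learners that ask one-sided threshold queries -/

/-- The query asking whether the sample is at least `τ`. -/
noncomputable def rayQuery (τ : ℝ) : Query := fun x => decide (τ ≤ x)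

/-- The left end point of the set where a query answers `true`. -/
noncomputable def rayEndpoint (Q : Query) : ℝ := sInf {x | Q x = true}

theorem rayEndpoint_rayQuery (τ : ℝ) : rayEndpoint (rayQuery τ) = τ := by
  have : {x | rayQuery τ x = true} = Set.Ici τ := by ext; simp [rayQuery]
  rw [rayEndpoint, this, csInf_Ici]

theorem isInterval_rayQuery (τ : ℝ) : (rayQuery τ).IsInterval :=
  ⟨τ, ⊤, fun x => by simp [rayQuery]⟩

/-- A learner with memory of type `S` that only asks queries `X ≥ τ`. In round `t`, in memory
state `x` and with a fresh random number `u`, it asks for the threshold `threshold t x u`; its next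
state `update t x τ y` is a function of the threshold `τ` that was asked and of the answer `y`, and
not of `u`, so that the state can be reconstructed from the transcript. -/
structure ThresholdLearner (S : Type) [MeasurableSpace S] where
  init : S
  threshold : ℕ → S → ℝ → ℝ
  update : ℕ → S → ℝ → Bool → S
  measurable_threshold : ∀ t, Measurable fun p : S × ℝ => threshold t p.1 p.2
  measurable_update : ∀ t, Measurable fun p : S × ℝ × Bool => update t p.1 p.2.1 p.2.2

namespace ThresholdLearner

variable {S : Type} [MeasurableSpace S] (A : ThresholdLearner S)

/-- The memory state reached after a given transcript. -/
noncomputable def stateOf : (t : ℕ) → Transcript t → S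
  | 0, _ => A.init
  | t + 1, h =>
    A.update t (stateOf t fun i => h i.castSucc) (rayEndpoint (h (Fin.last t)).1)
      (h (Fin.last t)).2

/-- The state after one round, as a function of the pair `z` of fresh random number and sample. -/
noncomputable def next (t : ℕ) (x : S) (z : ℝ × ℝ) : S :=
  A.update t x (A.threshold t x z.1) (decide (A.threshold t x z.1 ≤ z.2))

/-- The state after `t` rounds, as a function of all pairs of random number and sample. -/
noncomputable def run : (t : ℕ) → (Fin t → ℝ × ℝ) → S
  | 0, _ => A.init
  | t + 1, z => A.next t (run t fun i => z i.castSucc) (z (Fin.last t))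

/-- The query strategy of a threshold learner that is given `n` random numbers. -/
noncomputable def query (n : ℕ) (t : ℕ) (s : Fin n → ℝ) (h : Transcript t) : Query :=
  rayQuery (A.threshold t (A.stateOf t h) (if ht : t < n then s ⟨t, ht⟩ else 0))

theorem stateOf_runProtocol {n : ℕ} (s : Fin n → ℝ) (t : ℕ) (ht : t ≤ n) (x : Fin t → ℝ) :
    A.stateOf t (runProtocol (A.query n) s t x) =
      A.run t fun i => (s (Fin.castLE ht i), x i) := by
  induction t with
  | zero => rfl
  | succ t ih =>
    have ih' := ih (Nat.le_of_succ_le ht) (fun i => x i.castSucc)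
    have hlt : t < n := ht
    simp only [stateOf, runProtocol, Fin.snoc_castSucc, Fin.snoc_last, run, next]
    rw [ih']
    simp only [query, rayEndpoint_rayQuery, hlt, dite_true]
    rw [ih']
    rfl

theorem runProtocol_snd {n : ℕ} (s : Fin n → ℝ) (t : ℕ) (ht : t ≤ n) (x : Fin t → ℝ)
    (i : Fin t) :
    (runProtocol (A.query n) s t x i).2 =
      decide (A.threshold i
        (A.run i fun j => (s (Fin.castLE (i.2.le.trans ht) j), x (Fin.castLE i.2.le j)))
        (s (Fin.castLE ht i)) ≤ x i) := by
  induction t with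
  | zero => exact i.elim0
  | succ t ih =>
    have hlt : t < n := ht
    induction i using Fin.lastCases with
    | last =>
      simp only [runProtocol, Fin.snoc_last]
      simp only [query, A.stateOf_runProtocol s t hlt.le, rayQuery, hlt, dite_true]
      rfl
    | cast i =>
      simp only [runProtocol, Fin.snoc_castSucc]
      rw [ih hlt.le]
      rfl

theorem measurable_decide_le {α : Type*} [MeasurableSpace α] {f g : α → ℝ} (hf : Measurable f)
    (hg : Measurable g) : Measurable fun a => decide (f a ≤ g a) := by
  refine measurable_to_bool ?_
  have : (fun a => decide (f a ≤ g a)) ⁻¹' {true} = {a | f a ≤ g a} := by ext; simp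
  rw [this]
  exact measurableSet_le hf hg

theorem measurable_next (t : ℕ) : Measurable fun p : S × ℝ × ℝ => A.next t p.1 p.2 := by
  have h1 : Measurable fun p : S × ℝ × ℝ => A.threshold t p.1 p.2.1 :=
    (A.measurable_threshold t).comp (measurable_fst.prodMk (measurable_fst.comp measurable_snd))
  exact (A.measurable_update t).comp (measurable_fst.prodMk (h1.prodMk
    (measurable_decide_le h1 (measurable_snd.comp measurable_snd))))

theorem measurable_run (t : ℕ) : Measurable (A.run t) := by
  induction t with
  | zero => exact measurable_const
  | succ t ih =>
    exact (A.measurable_next t).comp ((ih.comp (by fun_prop)).prodMk (measurable_pi_apply _))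

/-- The 1-bit mean estimator given by `n` rounds of a threshold learner, followed by the estimate
`out` computed from the final memory state. The random numbers of the rounds are independent with
law `ν`. -/
noncomputable def toEstimator (n : ℕ) (ν : Measure ℝ) [IsProbabilityMeasure ν] (out : S → ℝ)
    (hout : Measurable out) : OneBitMeanEstimator n where
  Seed := Fin n → ℝ
  seedLaw := Measure.pi fun _ => ν
  query := A.query n
  estimate h := out (A.stateOf n h)
  measurable_message t := by
    simp only [A.runProtocol_snd _ n le_rfl]
    refine measurable_decide_le ((A.measurable_threshold t).comp
      (((A.measurable_run t).comp ?_).prodMk ?_)) ?_ <;> fun_prop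
  measurable_estimate := by
    simp only [A.stateOf_runProtocol _ n le_rfl]
    refine hout.comp ((A.measurable_run n).comp ?_)
    fun_prop

theorem usesIntervalQueries_toEstimator (n : ℕ) (ν : Measure ℝ) [IsProbabilityMeasure ν]
    (out : S → ℝ) (hout : Measurable out) :
    (A.toEstimator n ν out hout).UsesIntervalQueries :=
  fun _ _ _ => isInterval_rayQuery _

/-- If `V t` does not increase in expectation over any round, whatever the state at its
beginning, then the expected value of `V n` at the end is at most the initial value of `V 0`. -/
theorem lintegral_run_le (P : Measure (ℝ × ℝ)) [IsProbabilityMeasure P] (V : ℕ → S → ENNReal)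
    (hV : ∀ t, Measurable (V t)) (n : ℕ)
    (step : ∀ t < n, ∀ x, ∫⁻ z, V (t + 1) (A.next t x z) ∂P ≤ V t x) :
    ∫⁻ z, V n (A.run n z) ∂(Measure.pi fun _ => P) ≤ V 0 A.init := by
  induction n with
  | zero => simp [run]
  | succ n ih =>
    refine le_trans ?_ (ih fun t ht => step t (by omega))
    have e := (measurePreserving_piFinSuccAbove (fun _ : Fin (n + 1) => P) (Fin.last n)).symm
    have hm := (hV (n + 1)).comp (A.measurable_run (n + 1))
    change ∫⁻ z, (V (n + 1) ∘ A.run (n + 1)) z ∂_ ≤ _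
    rw [← e.lintegral_comp hm]
    have hm2 := hm.comp e.measurable
    refine (lintegral_prod_symm _ hm2.aemeasurable).trans_le (lintegral_mono fun z => ?_)
    refine le_trans (le_of_eq ?_) (step n (by omega) (A.run n z))
    refine lintegral_congr fun w => ?_
    simp [run, MeasurableEquiv.piFinSuccAbove, Fin.insertNthEquiv]

/-- A threshold learner is accurate on `D` if a potential that dominates the indicator of a wrong
final estimate is a supermartingale with initial value at most `δ`. -/
theorem le_measure_output_toEstimator (n : ℕ) (ν : Measure ℝ) [IsProbabilityMeasure ν]
    (out : S → ℝ) (hout : Measurable out) (D : Measure ℝ) [IsProbabilityMeasure D] {a ε δ : ℝ}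
    (V : ℕ → S → ENNReal) (hV : ∀ t, Measurable (V t))
    (step : ∀ t < n, ∀ x, ∫⁻ z, V (t + 1) (A.next t x z) ∂(ν.prod D) ≤ V t x)
    (final : ∀ x, ε < |out x - a| → 1 ≤ V n x) (init : V 0 A.init ≤ ENNReal.ofReal δ)
    (hδ : 0 ≤ δ) :
    ENNReal.ofReal (1 - δ) ≤
      ((A.toEstimator n ν out hout).seedLaw.prod (Measure.pi fun _ : Fin n => D))
        {p | |(A.toEstimator n ν out hout).output p - a| ≤ ε} := by
  have hms : MeasurableSet {z | |out (A.run n z) - a| ≤ ε} :=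
    measurableSet_le (((hout.comp (A.measurable_run n)).sub_const a).abs) measurable_const
  have hbad : (Measure.pi fun _ : Fin n => ν.prod D) {z | |out (A.run n z) - a| ≤ ε}ᶜ
      ≤ ENNReal.ofReal δ := by
    refine le_trans ?_ ((A.lintegral_run_le (ν.prod D) V hV n step).trans init)
    rw [← lintegral_indicator_one hms.compl]
    refine lintegral_mono fun z => ?_
    by_cases hz : z ∈ {z | |out (A.run n z) - a| ≤ ε}ᶜ
    · rw [Set.indicator_of_mem hz]
      exact final _ (not_le.1 hz)
    · rw [Set.indicator_of_notMem hz]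
      exact zero_le
  have h1 := prob_compl_eq_one_sub (μ := Measure.pi fun _ : Fin n => ν.prod D) hms.compl
  rw [compl_compl] at h1
  have hgood : ENNReal.ofReal (1 - δ) ≤
      (Measure.pi fun _ : Fin n => ν.prod D) {z | |out (A.run n z) - a| ≤ ε} := by
    rw [h1, ENNReal.ofReal_sub _ hδ, ENNReal.ofReal_one]
    exact tsub_le_tsub_left hbad _
  have hmp := measurePreserving_arrowProdEquivProdArrow ℝ ℝ (Fin n) (fun _ => ν) (fun _ => D)
  rw [← hmp.symm.measure_preimage hms.nullMeasurableSet] at hgood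
  refine hgood.trans_eq (congrArg _ (Set.ext fun p => ?_))
  change |out (A.run n fun i => (p.1 i, p.2 i)) - a| ≤ ε ↔
    |out (A.stateOf n (runProtocol (A.query n) p.1 n p.2)) - a| ≤ ε
  rw [A.stateOf_runProtocol p.1 n le_rfl p.2]
  rfl

end ThresholdLearner

/-! ### Randomized thresholds with a Cauchy law -/

/-- The value `(1{T ≤ w} - 1{T < 0}) / p(T)`, where `p` is the density of the standard Cauchy law.
For `T` with this law it is an unbiased estimate of `w`, and it depends on `w` only through the bit
`1{T ≤ w}`. -/
noncomputable def rayWeight (T : ℝ) (y : Bool) : ℝ :=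
  Real.pi * (1 + T ^ 2) * ((if y then 1 else 0) - (if T < 0 then 1 else 0))

theorem measurable_rayWeight : Measurable fun p : ℝ × Bool => rayWeight p.1 p.2 := by
  unfold rayWeight
  refine Measurable.mul (by fun_prop) (Measurable.sub ?_ ?_)
  · exact (measurable_of_finite fun y : Bool => if y = true then (1 : ℝ) else 0).comp measurable_snd
  · exact Measurable.ite (measurableSet_lt measurable_fst measurable_const) measurable_const
      measurable_const

theorem measurable_rayWeight_decide :
    Measurable fun p : ℝ × ℝ => rayWeight p.1 (decide (p.1 ≤ p.2)) :=
  measurable_rayWeight.comp (measurable_fst.prodMk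
    (ThresholdLearner.measurable_decide_le measurable_fst measurable_snd))

theorem abs_rayWeight_le (T w : ℝ) :
    |rayWeight T (decide (T ≤ w))| ≤
      {v : ℝ | |T| ≤ |v|}.indicator (fun _ => Real.pi * (1 + T ^ 2)) w := by
  have h0 : 0 ≤ Real.pi * (1 + T ^ 2) := by positivity
  have hz : 0 ≤ {v : ℝ | |T| ≤ |v|}.indicator (fun _ => Real.pi * (1 + T ^ 2)) w :=
    Set.indicator_nonneg (fun _ _ => h0) _
  unfold rayWeight
  by_cases hT : T < 0 <;> by_cases hw : T ≤ w
  · simpa [hT, hw] using hz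
  · rw [Set.indicator_of_mem]
    · simp [hT, hw, abs_of_nonneg h0]
    · push Not at hw
      simp only [Set.mem_ofPred_eq, abs_of_neg hT, abs_of_neg (hw.trans hT)]
      linarith
  · rw [Set.indicator_of_mem]
    · simp [hT, hw, abs_of_nonneg h0]
    · push Not at hT
      simp only [Set.mem_ofPred_eq, abs_of_nonneg hT, abs_of_nonneg (hT.trans hw)]
      exact hw
  · simpa [hT, hw] using hz

/-- The standard Cauchy law. -/
noncomputable abbrev cauchyLaw : Measure ℝ := ProbabilityTheory.cauchyMeasure 0 1

theorem cauchyPDF_smul_rayWeight (T : ℝ) (y : Bool) :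
    (ProbabilityTheory.cauchyPDF 0 1 T).toReal • rayWeight T y =
      (if y then 1 else 0) - (if T < 0 then 1 else 0) := by
  have h : 0 < 1 + T ^ 2 := by positivity
  rw [ProbabilityTheory.cauchyPDF_def,
    ENNReal.toReal_ofReal (ProbabilityTheory.cauchyPDF_pos 0 one_ne_zero T).le,
    ProbabilityTheory.cauchyPDFReal_def, rayWeight, smul_eq_mul]
  simp only [NNReal.coe_one, sub_zero]
  have := Real.pi_ne_zero
  field_simp
  rw [add_comm (T ^ 2)]

theorem cauchyLaw_eq :
    cauchyLaw = (volume : Measure ℝ).withDensity (ProbabilityTheory.cauchyPDF 0 1) := by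
  simp [ProbabilityTheory.cauchyMeasure]

theorem ray_sub_ray_eq (w : ℝ) :
    (fun T : ℝ => (if decide (T ≤ w) = true then (1 : ℝ) else 0) - (if T < 0 then 1 else 0)) =
      fun T => (Set.Icc 0 w).indicator 1 T - (Set.Ioo w 0).indicator 1 T := by
  funext T
  simp only [Set.indicator, Set.mem_Icc, Set.mem_Ioo, decide_eq_true_eq, Pi.one_apply]
  split_ifs <;> grind

theorem integral_rayWeight (w : ℝ) :
    Integrable (fun T => rayWeight T (decide (T ≤ w))) cauchyLaw ∧
      ∫ T, rayWeight T (decide (T ≤ w)) ∂cauchyLaw = w ∧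
      ∫ T, ‖rayWeight T (decide (T ≤ w))‖ ∂cauchyLaw ≤ |w| := by
  have hm := ProbabilityTheory.measurable_cauchyPDF 0 1
  have hlt : ∀ᵐ x : ℝ, ProbabilityTheory.cauchyPDF 0 1 x < ⊤ := by
    simp [ProbabilityTheory.cauchyPDF]
  have h1 : Integrable ((Set.Icc 0 w).indicator (1 : ℝ → ℝ)) :=
    (integrable_indicator_iff measurableSet_Icc).2 (integrableOn_const (C := (1 : ℝ)) (by simp))
  have h2 : Integrable ((Set.Ioo w 0).indicator (1 : ℝ → ℝ)) :=
    (integrable_indicator_iff measurableSet_Ioo).2 (integrableOn_const (C := (1 : ℝ)) (by simp))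
  have hv1 : ∫ T, (Set.Icc 0 w).indicator (1 : ℝ → ℝ) T = max w 0 := by
    rw [integral_indicator_one measurableSet_Icc]
    simp [Measure.real, ENNReal.toReal_ofReal']
  have hv2 : ∫ T, (Set.Ioo w 0).indicator (1 : ℝ → ℝ) T = max (-w) 0 := by
    rw [integral_indicator_one measurableSet_Ioo]
    simp [Measure.real, ENNReal.toReal_ofReal']
  rw [cauchyLaw_eq]
  refine ⟨?_, ?_, ?_⟩
  · rw [integrable_withDensity_iff_integrable_smul' hm hlt]
    simp only [cauchyPDF_smul_rayWeight]
    rw [ray_sub_ray_eq]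
    exact h1.sub h2
  · rw [integral_withDensity_eq_integral_toReal_smul hm hlt]
    simp only [cauchyPDF_smul_rayWeight]
    rw [ray_sub_ray_eq, integral_sub h1 h2, hv1, hv2]
    rcases le_total 0 w with h | h
    · rw [max_eq_left h, max_eq_right (by linarith)]; ring
    · rw [max_eq_right h, max_eq_left (by linarith)]; ring
  · rw [integral_withDensity_eq_integral_toReal_smul hm hlt]
    have : ∀ T, (ProbabilityTheory.cauchyPDF 0 1 T).toReal • ‖rayWeight T (decide (T ≤ w))‖ =
        ‖(Set.Icc 0 w).indicator (1 : ℝ → ℝ) T - (Set.Ioo w 0).indicator 1 T‖ := by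
      intro T
      rw [← congrFun (ray_sub_ray_eq w) T, ← cauchyPDF_smul_rayWeight, norm_smul,
        Real.norm_of_nonneg ENNReal.toReal_nonneg, smul_eq_mul]
    simp only [this]
    calc _ ≤ ∫ T, ((Set.Icc 0 w).indicator (1 : ℝ → ℝ) T + (Set.Ioo w 0).indicator 1 T) := by
            refine integral_mono (h1.sub h2).norm (h1.add h2) fun T => ?_
            refine (norm_sub_le _ _).trans_eq ?_
            rw [Real.norm_of_nonneg (Set.indicator_nonneg (by simp) _),
              Real.norm_of_nonneg (Set.indicator_nonneg (by simp) _)]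
      _ = |w| := by
            rw [integral_add h1 h2, hv1, hv2]
            rcases le_total 0 w with h | h
            · rw [max_eq_left h, max_eq_right (by linarith), abs_of_nonneg h]; ring
            · rw [max_eq_right h, max_eq_left (by linarith), abs_of_nonpos h]; ring

theorem exp_le_one_add_add_sq_mul (x : ℝ) :
    Real.exp x ≤ 1 + x + x ^ 2 * Real.exp |x| := by
  have h1 : Real.exp x - 1 ≤ x * Real.exp x := by
    have h := mul_le_mul_of_nonneg_right (Real.add_one_le_exp (-x)) (Real.exp_pos x).le
    rw [← Real.exp_add, neg_add_cancel, Real.exp_zero] at h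
    linarith
  rcases le_total 0 x with hx | hx
  · rw [abs_of_nonneg hx]
    nlinarith
  · have h2 := Real.add_one_le_exp x
    have h3 : 1 ≤ Real.exp |x| := Real.one_le_exp (abs_nonneg x)
    nlinarith [sq_nonneg x]

/-- The constant in the sub-exponential moment bound for the randomized threshold estimate. The
exponential compensates for a mean of up to `16`: the tail at distance `|T| - 16` is compared with
`exp (16 ^ 2 / 2 - T ^ 2 / 4)`. -/
noncomputable def mgfConst : ℝ := 5120 * Real.exp 129

theorem mgfConst_pos : 0 < mgfConst := by unfold mgfConst; positivity

theorem weight_mul_tail_le (T : ℝ) :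
    (Real.pi * (1 + T ^ 2)) ^ 2 * Real.exp ((1 + T ^ 2) / 8) *
      (2 * Real.exp (128 - T ^ 2 / 4)) ≤ mgfConst := by
  set v := 1 + T ^ 2 with hv
  have hv0 : 0 < v := by positivity
  have e1 : v ≤ 16 * Real.exp (v / 16) := by linarith [Real.add_one_le_exp (v / 16)]
  have e2 : v ^ 2 ≤ 256 * Real.exp (v / 8) := by
    calc v ^ 2 ≤ (16 * Real.exp (v / 16)) ^ 2 := by gcongr
      _ = 256 * Real.exp (v / 8) := by
        rw [mul_pow, ← Real.exp_nat_mul]; norm_num; ring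
  have hpi : Real.pi ^ 2 ≤ 10 := by nlinarith [Real.pi_lt_d2, Real.pi_pos]
  have hT : T ^ 2 = v - 1 := by rw [hv]; ring
  rw [hT]
  calc (Real.pi * v) ^ 2 * Real.exp (v / 8) * (2 * Real.exp (128 - (v - 1) / 4))
      = 2 * Real.pi ^ 2 * v ^ 2 * (Real.exp (v / 8) * Real.exp (128 - (v - 1) / 4)) := by ring
    _ ≤ 2 * 10 * (256 * Real.exp (v / 8)) *
          (Real.exp (v / 8) * Real.exp (128 - (v - 1) / 4)) := by gcongr
    _ = 5120 * Real.exp (v / 8 + (v / 8 + (128 - (v - 1) / 4))) := by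
        rw [Real.exp_add, Real.exp_add]; ring
    _ ≤ mgfConst := by
        unfold mgfConst
        gcongr
        linarith

/-- For a law with unit sub-Gaussian tails whose mean `a` is bounded by an absolute constant, the
randomized threshold estimate has mean `a` and sub-exponential moments: an unusually large weight
needs `|w|` to be at least `|T|`, which the Gaussian tail makes unlikely. -/
theorem lintegral_exp_rayWeight_le (ρ : Measure ℝ) [IsProbabilityMeasure ρ] {a s : ℝ}
    (ha : |a| ≤ 16) (hint : Integrable (fun w : ℝ => w) ρ) (hmean : ∫ w, w ∂ρ = a)
    (htail : ∀ t : ℝ, 0 ≤ t → ρ {w | t ≤ |w - a|} ≤ ENNReal.ofReal (2 * Real.exp (-t ^ 2 / 2)))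
    (hs : |s| ≤ 1 / (8 * Real.pi)) :
    ∫⁻ z, ENNReal.ofReal (Real.exp (s * rayWeight z.1 (decide (z.1 ≤ z.2)))) ∂(cauchyLaw.prod ρ) ≤
      ENNReal.ofReal (Real.exp (s * a + mgfConst * s ^ 2)) := by
  set g : ℝ × ℝ → ℝ := fun z => rayWeight z.1 (decide (z.1 ≤ z.2)) with hg
  have hgm : Measurable g := measurable_rayWeight_decide
  have hgi : Integrable g (cauchyLaw.prod ρ) := by
    rw [integrable_prod_iff' hgm.aestronglyMeasurable]
    refine ⟨Filter.Eventually.of_forall fun w => (integral_rayWeight w).1, ?_⟩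
    refine Integrable.mono' hint.abs
      (hgm.norm.stronglyMeasurable.integral_prod_left').aestronglyMeasurable ?_
    refine Filter.Eventually.of_forall fun w => ?_
    rw [Real.norm_of_nonneg (integral_nonneg fun _ => norm_nonneg _)]
    exact (integral_rayWeight w).2.2
  have hge : ∫ z, g z ∂(cauchyLaw.prod ρ) = a := by
    rw [integral_prod_symm _ hgi, ← hmean]
    exact integral_congr_ae (Filter.Eventually.of_forall fun w => (integral_rayWeight w).2.1)
  set q : ℝ × ℝ → ℝ := fun z => g z ^ 2 * Real.exp |s * g z| with hq
  have hqm : Measurable q := by fun_prop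
  have hq0 : ∀ z, 0 ≤ q z := fun z => by positivity
  have hqT : ∀ T, ∫⁻ w, ENNReal.ofReal (q (T, w)) ∂ρ ≤ ENNReal.ofReal mgfConst := by
    intro T
    set c := (Real.pi * (1 + T ^ 2)) ^ 2 * Real.exp ((1 + T ^ 2) / 8) with hc
    have hc0 : 0 ≤ c := by positivity
    have hset : MeasurableSet {v : ℝ | |T| ≤ |v|} := measurableSet_le measurable_const (by fun_prop)
    have hpt : ∀ w, ENNReal.ofReal (q (T, w)) ≤
        {v : ℝ | |T| ≤ |v|}.indicator (fun _ => ENNReal.ofReal c) w := by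
      intro w
      have hb := abs_rayWeight_le T w
      by_cases hw : w ∈ {v : ℝ | |T| ≤ |v|}
      · rw [Set.indicator_of_mem hw] at hb ⊢
        refine ENNReal.ofReal_le_ofReal ?_
        have h1 : |s * g (T, w)| ≤ (1 + T ^ 2) / 8 := by
          rw [abs_mul]
          calc |s| * |g (T, w)| ≤ 1 / (8 * Real.pi) * (Real.pi * (1 + T ^ 2)) := by gcongr
            _ = (1 + T ^ 2) / 8 := by field_simp
        have h2 : g (T, w) ^ 2 ≤ (Real.pi * (1 + T ^ 2)) ^ 2 := by
          rw [← sq_abs]; gcongr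
        exact mul_le_mul h2 (Real.exp_le_exp.2 h1) (Real.exp_pos _).le (by positivity)
      · rw [Set.indicator_of_notMem hw] at hb ⊢
        have : g (T, w) = 0 := abs_nonpos_iff.1 hb
        simp [hq, this]
    have hρ : ρ {v : ℝ | |T| ≤ |v|} ≤ ENNReal.ofReal (2 * Real.exp (128 - T ^ 2 / 4)) := by
      rcases le_total 16 |T| with hT | hT
      · have hsub : {v : ℝ | |T| ≤ |v|} ⊆ {w | |T| - 16 ≤ |w - a|} := by
          intro v hv
          have : |v| - |a| ≤ |v - a| := abs_sub_abs_le_abs_sub v a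
          simp only [Set.mem_ofPred_eq] at hv ⊢
          linarith
        refine (measure_mono hsub).trans ((htail _ (by linarith)).trans ?_)
        refine ENNReal.ofReal_le_ofReal ?_
        gcongr
        nlinarith [sq_nonneg (|T| - 32), sq_abs T]
      · refine prob_le_one.trans ?_
        rw [ENNReal.one_le_ofReal]
        have : T ^ 2 ≤ 256 := by nlinarith [sq_abs T, abs_nonneg T]
        have : 1 ≤ Real.exp (128 - T ^ 2 / 4) := Real.one_le_exp (by linarith)
        linarith
    calc ∫⁻ w, ENNReal.ofReal (q (T, w)) ∂ρ
        ≤ ∫⁻ w, {v : ℝ | |T| ≤ |v|}.indicator (fun _ => ENNReal.ofReal c) w ∂ρ :=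
          lintegral_mono hpt
      _ = ENNReal.ofReal c * ρ {v : ℝ | |T| ≤ |v|} := lintegral_indicator_const hset _
      _ ≤ ENNReal.ofReal c * ENNReal.ofReal (2 * Real.exp (128 - T ^ 2 / 4)) := by gcongr
      _ = ENNReal.ofReal (c * (2 * Real.exp (128 - T ^ 2 / 4))) := (ENNReal.ofReal_mul hc0).symm
      _ ≤ ENNReal.ofReal mgfConst := ENNReal.ofReal_le_ofReal (weight_mul_tail_le T)
  have hql : ∫⁻ z, ENNReal.ofReal (q z) ∂(cauchyLaw.prod ρ) ≤ ENNReal.ofReal mgfConst := by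
    rw [lintegral_prod _ hqm.ennreal_ofReal.aemeasurable]
    calc _ ≤ ∫⁻ _, ENNReal.ofReal mgfConst ∂cauchyLaw := lintegral_mono hqT
      _ = _ := by simp
  have hqi : Integrable q (cauchyLaw.prod ρ) := by
    refine ⟨hqm.aestronglyMeasurable, ?_⟩
    rw [hasFiniteIntegral_iff_ofReal (Filter.Eventually.of_forall hq0)]
    exact hql.trans_lt ENNReal.ofReal_lt_top
  have hqv : ∫ z, q z ∂(cauchyLaw.prod ρ) ≤ mgfConst := by
    rw [integral_eq_lintegral_of_nonneg_ae (Filter.Eventually.of_forall hq0)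
      hqm.aestronglyMeasurable]
    exact ENNReal.toReal_le_of_le_ofReal mgfConst_pos.le hql
  have hle : ∀ z, Real.exp (s * g z) ≤ 1 + s * g z + s ^ 2 * q z := fun z => by
    have := exp_le_one_add_add_sq_mul (s * g z)
    simp only [hq]
    linarith [congrArg (· * Real.exp |s * g z|) (mul_pow s (g z) 2)]
  have hgi' : Integrable (fun z => 1 + s * g z) (cauchyLaw.prod ρ) :=
    (integrable_const 1).add (hgi.const_mul s)
  have hfi : Integrable (fun z => 1 + s * g z + s ^ 2 * q z) (cauchyLaw.prod ρ) :=
    hgi'.add (hqi.const_mul _)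
  calc ∫⁻ z, ENNReal.ofReal (Real.exp (s * g z)) ∂(cauchyLaw.prod ρ)
      ≤ ∫⁻ z, ENNReal.ofReal (1 + s * g z + s ^ 2 * q z) ∂(cauchyLaw.prod ρ) :=
        lintegral_mono fun z => ENNReal.ofReal_le_ofReal (hle z)
    _ = ENNReal.ofReal (∫ z, (1 + s * g z + s ^ 2 * q z) ∂(cauchyLaw.prod ρ)) :=
        (ofReal_integral_eq_lintegral_ofReal hfi (Filter.Eventually.of_forall fun z =>
          (Real.exp_pos _).le.trans (hle z))).symm
    _ ≤ _ := by
        refine ENNReal.ofReal_le_ofReal ?_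
        rw [integral_add hgi' (hqi.const_mul _),
          integral_add (integrable_const 1) (hgi.const_mul s), integral_const_mul,
          integral_const_mul, hge]
        simp only [integral_const, probReal_univ, smul_eq_mul, mul_one]
        have := Real.add_one_le_exp (s * a + mgfConst * s ^ 2)
        nlinarith [mul_le_mul_of_nonneg_left hqv (sq_nonneg s)]

/-! ### Locating the mean up to a constant number of standard deviations -/

/-- The relative step size of the search when the mean is believed to be within `b` standard
deviations of the current centre. It is of constant order while `b ^ 2` exceeds `L`, where a single
answer is wrong with probability `exp (-Ω(L))`, and decreases like `b ^ 2 / L` afterwards. -/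
noncomputable def shrinkRate (L b : ℝ) : ℝ := b ^ 2 / (256 * (L + b ^ 2))

/-- The radius, in standard deviations, to which the search has located the mean after `t`
rounds. -/
noncomputable def radius (L b₀ : ℝ) : ℕ → ℝ
  | 0 => b₀
  | t + 1 => radius L b₀ t * (1 - shrinkRate L (radius L b₀ t) / 2)

theorem shrinkRate_pos {L b : ℝ} (hL : 0 ≤ L) (hb : 0 < b) : 0 < shrinkRate L b := by
  unfold shrinkRate; positivity

theorem shrinkRate_le {L b : ℝ} (hL : 0 ≤ L) (hb : 0 < b) : shrinkRate L b ≤ 1 / 256 := by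
  unfold shrinkRate
  rw [div_le_div_iff₀ (by positivity) (by norm_num)]
  nlinarith

theorem radius_pos {L b₀ : ℝ} (hL : 0 ≤ L) (hb : 0 < b₀) (t : ℕ) : 0 < radius L b₀ t := by
  induction t with
  | zero => exact hb
  | succ t ih =>
    have := shrinkRate_le hL ih
    exact mul_pos ih (by linarith)

/-- Each step decreases `log b - L / (2 b ^ 2)` by a constant: its derivative in `b` is
`(b ^ 2 + L) / b ^ 3`, the reciprocal of the decrease of `b` up to a constant factor. -/
theorem log_sub_radius_succ_le {L b : ℝ} (hL : 0 ≤ L) (hb : 0 < b) :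
    Real.log (b * (1 - shrinkRate L b / 2)) - L / (2 * (b * (1 - shrinkRate L b / 2)) ^ 2) ≤
      Real.log b - L / (2 * b ^ 2) - 1 / 512 := by
  set ζ := shrinkRate L b with hζ
  have hpos := shrinkRate_pos hL hb
  have hle := shrinkRate_le hL hb
  have hr : 0 < 1 - ζ / 2 := by linarith
  rw [Real.log_mul hb.ne' hr.ne']
  have h1 : Real.log (1 - ζ / 2) ≤ -(ζ / 2) := by
    linarith [Real.log_le_sub_one_of_pos hr]
  have h2 : L / (2 * b ^ 2) * (1 + ζ) ≤ L / (2 * (b * (1 - ζ / 2)) ^ 2) := by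
    have h3 : 1 + ζ ≤ 1 / (1 - ζ / 2) ^ 2 := by
      rw [le_div_iff₀ (by positivity)]
      nlinarith [hpos.le, sq_nonneg ζ, mul_pos hpos hpos]
    calc L / (2 * b ^ 2) * (1 + ζ) ≤ L / (2 * b ^ 2) * (1 / (1 - ζ / 2) ^ 2) := by gcongr
      _ = L / (2 * (b * (1 - ζ / 2)) ^ 2) := by
        rw [div_mul_div_comm, mul_one]; congr 1; ring
  have h4 : ζ / 2 + L / (2 * b ^ 2) * ζ = 1 / 512 := by
    rw [hζ, shrinkRate]
    have : L + b ^ 2 ≠ 0 := by positivity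
    field_simp
    ring
  nlinarith

theorem exists_radius_le {L b₀ : ℝ} (hL : 0 ≤ L) (hb : 16 < b₀) :
    ∃ m : ℕ, radius L b₀ m ≤ 16 ∧ (∀ t < m, 16 < radius L b₀ t) ∧
      (m : ℝ) ≤ 512 * Real.log (b₀ / 16) + L + 1 := by
  have hb0 : 0 < b₀ := by linarith
  have hdec : ∀ t : ℕ, Real.log (radius L b₀ t) - L / (2 * radius L b₀ t ^ 2) ≤
      Real.log b₀ - L / (2 * b₀ ^ 2) - t / 512 := by
    intro t
    induction t with
    | zero => simp [radius]
    | succ t ih =>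
      have := log_sub_radius_succ_le hL (radius_pos hL hb0 t)
      simp only [radius]
      push_cast
      linarith
  have hstay : ∀ t : ℕ, 16 < radius L b₀ t → (t : ℝ) ≤ 512 * Real.log (b₀ / 16) + L := by
    intro t ht
    have h1 := hdec t
    have h2 : Real.log 16 ≤ Real.log (radius L b₀ t) := Real.log_le_log (by norm_num) ht.le
    have h3 : L / (2 * radius L b₀ t ^ 2) ≤ L / (2 * 16 ^ 2) := by gcongr
    have h4 : 0 ≤ L / (2 * b₀ ^ 2) := by positivity
    rw [Real.log_div hb0.ne' (by norm_num)]
    linarith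
  have hex : ∃ t, radius L b₀ t ≤ 16 := by
    by_contra! h
    obtain ⟨t, ht⟩ := exists_nat_gt (512 * Real.log (b₀ / 16) + L)
    linarith [hstay t (h t)]
  classical
  refine ⟨Nat.find hex, Nat.find_spec hex, fun t ht => not_le.1 (Nat.find_min hex ht), ?_⟩
  rcases hm : Nat.find hex with _ | t
  · have := Nat.find_spec hex
    rw [hm] at this
    exact absurd this (not_le.2 hb)
  · have := hstay t (not_le.1 (Nat.find_min hex (by omega)))
    push_cast
    linarith

/-- The potential of the search: `x` is the distance from the centre to the mean. -/
noncomputable def searchPotential (L b x : ℝ) : ℝ := Real.exp (8 * L * (x / b - 1))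

theorem searchPotential_le_of_correct {L b x : ℝ} (hL : 0 ≤ L) (hb : 0 < b) (hxb : x ≤ b) :
    searchPotential L (b * (1 - shrinkRate L b / 2)) (x - shrinkRate L b * b) ≤
      searchPotential L b x * Real.exp (-(4 * L * shrinkRate L b)) := by
  unfold searchPotential
  rw [← Real.exp_add, Real.exp_le_exp]
  set ζ := shrinkRate L b
  have hpos : 0 < ζ := shrinkRate_pos hL hb
  have hle : ζ ≤ 1 / 256 := shrinkRate_le hL hb
  have hr : 0 < 1 - ζ / 2 := by linarith
  have key : (x - ζ * b) / (b * (1 - ζ / 2)) ≤ x / b - ζ / 2 := by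
    rw [div_le_iff₀ (by positivity)]
    have : (x / b - ζ / 2) * (b * (1 - ζ / 2)) = (x - ζ * b / 2) * (1 - ζ / 2) := by
      field_simp
    rw [this]
    nlinarith [mul_pos hpos hb, mul_pos (mul_pos hpos hpos) hb]
  nlinarith [mul_le_mul_of_nonneg_left key hL]

theorem searchPotential_le_of_wrong {L b x : ℝ} (hL : 0 ≤ L) (hb : 0 < b) (hxb : x ≤ b) :
    searchPotential L (b * (1 - shrinkRate L b / 2)) (x + shrinkRate L b * b) ≤
      searchPotential L b x * Real.exp (16 * L * shrinkRate L b) := by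
  unfold searchPotential
  rw [← Real.exp_add, Real.exp_le_exp]
  set ζ := shrinkRate L b
  have hpos : 0 < ζ := shrinkRate_pos hL hb
  have hle : ζ ≤ 1 / 256 := shrinkRate_le hL hb
  have hr : 0 < 1 - ζ / 2 := by linarith
  have key : (x + ζ * b) / (b * (1 - ζ / 2)) ≤ x / b + 2 * ζ := by
    rw [div_le_iff₀ (by positivity)]
    have : (x / b + 2 * ζ) * (b * (1 - ζ / 2)) = (x + 2 * ζ * b) * (1 - ζ / 2) := by
      field_simp
    rw [this]
    nlinarith [mul_pos hpos hb, mul_pos (mul_pos hpos hpos) hb]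
  nlinarith [mul_le_mul_of_nonneg_left key hL]

theorem searchPotential_le_of_near {L b x : ℝ} (hL : 0 ≤ L) (hb : 0 < b) (hx : x ≤ b / 2) :
    searchPotential L (b * (1 - shrinkRate L b / 2)) (x + shrinkRate L b * b) ≤
      Real.exp (-(2 * L)) := by
  unfold searchPotential
  rw [Real.exp_le_exp]
  set ζ := shrinkRate L b
  have hle : ζ ≤ 1 / 256 := shrinkRate_le hL hb
  have hr : 0 < 1 - ζ / 2 := by linarith
  have key : (x + ζ * b) / (b * (1 - ζ / 2)) ≤ 3 / 4 := by
    rw [div_le_iff₀ (by positivity)]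
    nlinarith
  nlinarith [mul_le_mul_of_nonneg_left key hL]

theorem searchPotential_mono {L b x y : ℝ} (hL : 0 ≤ L) (hb : 0 < b) (h : x ≤ y) :
    searchPotential L b x ≤ searchPotential L b y := by
  unfold searchPotential
  gcongr

theorem search_drift_le_one {L b : ℝ} (hL : 128 ≤ L) (hb : 16 ≤ b) :
    Real.exp (-(4 * L * shrinkRate L b)) +
      Real.exp (16 * L * shrinkRate L b) * (2 * Real.exp (-(b / 2) ^ 2 / 2)) ≤ 1 := by
  have hb2 : 256 ≤ b ^ 2 := by nlinarith
  have h1 : 1 ≤ 4 * L * shrinkRate L b := by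
    rw [shrinkRate, mul_div_assoc', le_div_iff₀ (by positivity)]
    nlinarith [mul_nonneg (sub_nonneg.2 hL) (sub_nonneg.2 hb2)]
  have h2 : 16 * L * shrinkRate L b ≤ b ^ 2 / 16 := by
    rw [shrinkRate, mul_div_assoc', div_le_div_iff₀ (by positivity) (by norm_num)]
    nlinarith [mul_nonneg (sq_nonneg b) (sq_nonneg b)]
  have h3 : Real.exp (-(4 * L * shrinkRate L b)) ≤ 1 / 2 := by
    calc _ ≤ Real.exp (-1) := by gcongr
      _ ≤ 1 / 2 := by linarith [Real.exp_neg_one_lt_half]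
  have h4 : Real.exp (16 * L * shrinkRate L b) * (2 * Real.exp (-(b / 2) ^ 2 / 2)) ≤ 1 / 2 := by
    calc _ = 2 * Real.exp (16 * L * shrinkRate L b + -(b / 2) ^ 2 / 2) := by
          rw [Real.exp_add]; ring
      _ ≤ 2 * Real.exp (-16) := by gcongr; nlinarith
      _ ≤ 1 / 2 := by
        have : Real.exp (-16) ≤ 1 / 4 := by
          rw [Real.exp_neg, inv_le_comm₀ (Real.exp_pos _) (by norm_num)]
          linarith [Real.add_one_le_exp (16 : ℝ)]
        linarith
  linarith

theorem measure_ge_le_of_tail {D : Measure ℝ} {σ a w : ℝ} (hσ : 0 < σ) (hw : 0 ≤ w)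
    (htail : ∀ t : ℝ, 0 ≤ t →
      D {x | t ≤ |x - σ * a|} ≤ ENNReal.ofReal (2 * Real.exp (-t ^ 2 / (2 * σ ^ 2))))
    {W : Set ℝ} (hW : ∀ x ∈ W, σ * w ≤ |x - σ * a|) :
    D W ≤ ENNReal.ofReal (2 * Real.exp (-w ^ 2 / 2)) := by
  refine (measure_mono hW).trans ((htail (σ * w) (by positivity)).trans_eq ?_)
  congr 3
  field_simp

/-- One step of the search, `a` being the mean in units of `σ`. If the centre is at a distance
between `b / 2` and `b` from `a`, then the answer is correct up to a probability
`2 exp (-b ^ 2 / 8)`; if it is closer, then no answer can make the new potential large; if it is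
further away, then the right hand side exceeds `1`. -/
theorem lintegral_searchPotential_le {D : Measure ℝ} [IsProbabilityMeasure D] {σ a θ L b c : ℝ}
    (hσ : 0 < σ)
    (htail : ∀ t : ℝ, 0 ≤ t →
      D {x | t ≤ |x - σ * a|} ≤ ENNReal.ofReal (2 * Real.exp (-t ^ 2 / (2 * σ ^ 2))))
    (hL : 128 ≤ L) (hb : 16 ≤ b) (hc : 0 ≤ c) :
    ∫⁻ x, min 1 (ENNReal.ofReal (c + searchPotential L (b * (1 - shrinkRate L b / 2))
        |θ + (if decide (σ * θ ≤ x) then 1 else -1) * (shrinkRate L b * b) - a|)) ∂D ≤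
      ENNReal.ofReal (c + Real.exp (-(2 * L)) + searchPotential L b |θ - a|) := by
  have hL0 : 0 ≤ L := by linarith
  have hb0 : 0 < b := by linarith
  set ζ := shrinkRate L b with hζ
  have hpos : 0 < ζ := shrinkRate_pos hL0 hb0
  have hle : ζ ≤ 1 / 256 := shrinkRate_le hL0 hb0
  have hζb : 0 < ζ * b := by positivity
  have hb' : 0 < b * (1 - ζ / 2) := mul_pos hb0 (by linarith)
  have hall : ∀ x : ℝ, |θ + (if decide (σ * θ ≤ x) then 1 else -1) * (ζ * b) - a| ≤
      |θ - a| + ζ * b := by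
    intro x
    split_ifs
    · calc _ = |(θ - a) + ζ * b| := by ring_nf
        _ ≤ |θ - a| + |ζ * b| := abs_add_le _ _
        _ = _ := by rw [abs_of_pos hζb]
    · calc _ = |(θ - a) - ζ * b| := by ring_nf
        _ ≤ |θ - a| + |ζ * b| := abs_sub _ _
        _ = _ := by rw [abs_of_pos hζb]
  have hprob : ∀ r : ENNReal, ∫⁻ _, r ∂D = r := fun r => by simp
  rcases le_or_gt b |θ - a| with hfar | hfar
  · refine (lintegral_mono fun x => min_le_left _ _).trans ?_
    rw [hprob, ENNReal.one_le_ofReal]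
    have : 1 ≤ searchPotential L b |θ - a| := by
      refine Real.one_le_exp (mul_nonneg (by positivity) ?_)
      rw [sub_nonneg, one_le_div hb0]
      exact hfar
    linarith [Real.exp_pos (-(2 * L))]
  rcases le_or_gt |θ - a| (b / 2) with hnear | hnear
  · calc _ ≤ ∫⁻ _, ENNReal.ofReal (c + Real.exp (-(2 * L)) + searchPotential L b |θ - a|) ∂D := by
          refine lintegral_mono fun x => (min_le_right _ _).trans (ENNReal.ofReal_le_ofReal ?_)
          have h1 := (searchPotential_mono hL0 hb' (hall x)).trans
            (searchPotential_le_of_near hL0 hb0 hnear)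
          have h2 : 0 < searchPotential L b |θ - a| := Real.exp_pos _
          linarith
      _ = _ := hprob _
  · obtain ⟨W, hWm, hWD, hW⟩ : ∃ W : Set ℝ, MeasurableSet W ∧
        D W ≤ ENNReal.ofReal (2 * Real.exp (-(b / 2) ^ 2 / 2)) ∧
        ∀ x ∉ W, |θ + (if decide (σ * θ ≤ x) then 1 else -1) * (ζ * b) - a| ≤
          |θ - a| - ζ * b := by
      have hsmall : ζ * b ≤ b / 2 := by nlinarith
      rcases le_total a θ with h | h
      · rw [abs_of_nonneg (sub_nonneg.2 h)] at hnear ⊢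
        refine ⟨Set.Ici (σ * θ), measurableSet_Ici, ?_, fun x hx => ?_⟩
        · refine measure_ge_le_of_tail hσ (by positivity) htail fun x hx => ?_
          rw [Set.mem_Ici] at hx
          exact le_trans (by nlinarith) (le_abs_self _)
        · rw [Set.mem_Ici] at hx
          simp only [hx, decide_false, Bool.false_eq_true, if_false]
          rw [abs_of_nonneg] <;> linarith
      · rw [abs_of_nonpos (sub_nonpos.2 h)] at hnear ⊢
        refine ⟨Set.Iio (σ * θ), measurableSet_Iio, ?_, fun x hx => ?_⟩
        · refine measure_ge_le_of_tail hσ (by positivity) htail fun x hx => ?_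
          rw [Set.mem_Iio] at hx
          exact le_trans (by nlinarith) (neg_le_abs _)
        · rw [Set.mem_Iio, not_lt] at hx
          simp only [hx, decide_true, if_true]
          rw [abs_of_nonpos] <;> linarith
    set E := searchPotential L b |θ - a| with hE
    have hE0 : 0 < E := Real.exp_pos _
    set q := 2 * Real.exp (-(b / 2) ^ 2 / 2) with hq
    have hq0 : 0 < q := by positivity
    set g := Real.exp (-(4 * L * ζ))
    have hg0 : 0 < g := Real.exp_pos _
    set r := Real.exp (16 * L * ζ)
    have hr0 : 0 < r := Real.exp_pos _
    calc _ ≤ ∫⁻ x, (ENNReal.ofReal (c + E * g) +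
            W.indicator (fun _ => ENNReal.ofReal (E * r)) x) ∂D := by
          refine lintegral_mono fun x => (min_le_right _ _).trans ?_
          by_cases hx : x ∈ W
          · rw [Set.indicator_of_mem hx, ← ENNReal.ofReal_add (by positivity) (by positivity)]
            refine ENNReal.ofReal_le_ofReal ?_
            have := (searchPotential_mono hL0 hb' (hall x)).trans
              (searchPotential_le_of_wrong hL0 hb0 hfar.le)
            have : 0 < E * g := by positivity
            linarith
          · rw [Set.indicator_of_notMem hx, add_zero]
            refine ENNReal.ofReal_le_ofReal ?_
            have := (searchPotential_mono hL0 hb' (hW x hx)).trans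
              (searchPotential_le_of_correct hL0 hb0 hfar.le)
            linarith
      _ = ENNReal.ofReal (c + E * g) + ENNReal.ofReal (E * r) * D W := by
          rw [lintegral_add_left measurable_const, hprob, lintegral_indicator_const hWm]
      _ ≤ ENNReal.ofReal (c + E * g) + ENNReal.ofReal (E * r) * ENNReal.ofReal q := by gcongr
      _ = ENNReal.ofReal (c + E * g + E * r * q) := by
          rw [← ENNReal.ofReal_mul (by positivity),
            ← ENNReal.ofReal_add (by positivity) (by positivity)]
      _ ≤ _ := by
          refine ENNReal.ofReal_le_ofReal ?_
          have h1 : g + r * q ≤ 1 := search_drift_le_one hL hb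
          nlinarith [Real.exp_pos (-(2 * L)), mul_le_mul_of_nonneg_left h1 hE0.le]

/-! ### Averaging randomized threshold answers -/

theorem lintegral_exp_rayWeight_sample_le {D : Measure ℝ} [IsProbabilityMeasure D] {σ a θ s : ℝ}
    (hσ : 0 < σ) (hint : Integrable (fun x : ℝ => x) D) (hmean : ∫ x, x ∂D = σ * a)
    (htail : ∀ t : ℝ, 0 ≤ t →
      D {x | t ≤ |x - σ * a|} ≤ ENNReal.ofReal (2 * Real.exp (-t ^ 2 / (2 * σ ^ 2))))
    (hθ : |θ - a| ≤ 16) (hs : |s| ≤ 1 / (8 * Real.pi)) :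
    ∫⁻ z, ENNReal.ofReal (Real.exp (s * rayWeight z.1 (decide (σ * (θ + z.1) ≤ z.2))))
      ∂(cauchyLaw.prod D) ≤ ENNReal.ofReal (Real.exp (s * (a - θ) + mgfConst * s ^ 2)) := by
  set φ : ℝ → ℝ := fun x => x / σ - θ with hφ
  have hφm : Measurable φ := by fun_prop
  have hdec : ∀ T x : ℝ, decide (σ * (θ + T) ≤ x) = decide (T ≤ φ x) := by
    intro T x
    refine decide_eq_decide.2 ?_
    rw [hφ, le_sub_iff_add_le, le_div_iff₀ hσ, add_comm T, mul_comm]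
  have hprob : IsProbabilityMeasure (D.map φ) := Measure.isProbabilityMeasure_map hφm.aemeasurable
  have hφi : Integrable φ D := (hint.div_const σ).sub (integrable_const θ)
  have hmp : MeasurePreserving (Prod.map id φ) (cauchyLaw.prod D) (cauchyLaw.prod (D.map φ)) :=
    (MeasurePreserving.id cauchyLaw).prod ⟨hφm, rfl⟩
  have hFm : Measurable fun z : ℝ × ℝ =>
      ENNReal.ofReal (Real.exp (s * rayWeight z.1 (decide (z.1 ≤ z.2)))) :=
    (Real.measurable_exp.comp (measurable_rayWeight_decide.const_mul s)).ennreal_ofReal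
  have key := lintegral_exp_rayWeight_le (D.map φ) (a := a - θ) (s := s)
    (by rwa [abs_sub_comm]) ?_ ?_ ?_ hs
  · rw [← hmp.lintegral_comp hFm] at key
    refine (lintegral_congr fun z => ?_).trans_le key
    rw [hdec]
    rfl
  · exact (integrable_map_measure aestronglyMeasurable_id hφm.aemeasurable).2 hφi
  · rw [integral_map (f := fun w => w) hφm.aemeasurable measurable_id.aestronglyMeasurable]
    simp only [hφ]
    rw [integral_sub (hint.div_const σ) (integrable_const θ), integral_div, hmean]
    simp only [integral_const, probReal_univ, smul_eq_mul, one_mul]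
    field_simp
  · intro t ht
    rw [Measure.map_apply hφm (measurableSet_le measurable_const (by fun_prop))]
    refine measure_ge_le_of_tail hσ ht htail fun x hx => ?_
    have hx' : t ≤ |x / σ - θ - (a - θ)| := hx
    have h1 : |x - σ * a| = σ * |x / σ - θ - (a - θ)| := by
      rw [← abs_of_pos hσ, ← abs_mul, abs_of_pos hσ]
      congr 1
      field_simp
      ring
    rw [h1]
    gcongr

/-- The Chernoff potential after `j` out of `N` rounds of averaging, where the state consists of the
centre and of the sum of the weights, and a deviation `e` from the mean `a` is not tolerated. -/
noncomputable def averagePotential (a s e : ℝ) (N j : ℕ) (p : ℝ × ℝ) : ℝ :=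
  if |p.1 - a| ≤ 16 then
    Real.exp (s * (p.2 - j * (a - p.1)) + (((N : ℝ) - j) * (mgfConst * s ^ 2) - s * (N * e))) +
    Real.exp (-s * (p.2 - j * (a - p.1)) + (((N : ℝ) - j) * (mgfConst * s ^ 2) - s * (N * e)))
  else 1

theorem measurable_averagePotential (a s e : ℝ) (N j : ℕ) :
    Measurable (averagePotential a s e N j) := by
  refine Measurable.ite (measurableSet_le (by fun_prop) measurable_const) ?_ measurable_const
  fun_prop

theorem lintegral_averagePotential_succ_le {D : Measure ℝ} [IsProbabilityMeasure D]
    {σ a s : ℝ} (hσ : 0 < σ) (hint : Integrable (fun x : ℝ => x) D)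
    (hmean : ∫ x, x ∂D = σ * a)
    (htail : ∀ t : ℝ, 0 ≤ t →
      D {x | t ≤ |x - σ * a|} ≤ ENNReal.ofReal (2 * Real.exp (-t ^ 2 / (2 * σ ^ 2))))
    (hs : |s| ≤ 1 / (8 * Real.pi)) (e : ℝ) (N j : ℕ) (p : ℝ × ℝ) :
    ∫⁻ z, ENNReal.ofReal (averagePotential a s e N (j + 1)
        (p.1, p.2 + rayWeight z.1 (decide (σ * (p.1 + z.1) ≤ z.2)))) ∂(cauchyLaw.prod D) ≤
      ENNReal.ofReal (averagePotential a s e N j p) := by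
  unfold averagePotential
  by_cases hp : |p.1 - a| ≤ 16
  · simp only [hp, if_true]
    have hone : ∀ r : ℝ, |r| ≤ 1 / (8 * Real.pi) → r ^ 2 = s ^ 2 →
        ∫⁻ z : ℝ × ℝ, ENNReal.ofReal (Real.exp (r * (p.2 +
          rayWeight z.1 (decide (σ * (p.1 + z.1) ≤ z.2)) - (j + 1 : ℕ) * (a - p.1)) +
          (((N : ℝ) - (j + 1 : ℕ)) * (mgfConst * s ^ 2) - s * (N * e)))) ∂(cauchyLaw.prod D) ≤
        ENNReal.ofReal (Real.exp (r * (p.2 - j * (a - p.1)) +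
          (((N : ℝ) - j) * (mgfConst * s ^ 2) - s * (N * e)))) := by
      intro r hr hrs
      set A := Real.exp (r * (p.2 - (j + 1 : ℕ) * (a - p.1)) +
          (((N : ℝ) - (j + 1 : ℕ)) * (mgfConst * s ^ 2) - s * (N * e)))
      have hsplit : ∀ z : ℝ × ℝ, ENNReal.ofReal (Real.exp (r * (p.2 +
          rayWeight z.1 (decide (σ * (p.1 + z.1) ≤ z.2)) - (j + 1 : ℕ) * (a - p.1)) +
          (((N : ℝ) - (j + 1 : ℕ)) * (mgfConst * s ^ 2) - s * (N * e)))) = ENNReal.ofReal A *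
          ENNReal.ofReal (Real.exp (r * rayWeight z.1 (decide (σ * (p.1 + z.1) ≤ z.2)))) := by
        intro z
        rw [← ENNReal.ofReal_mul (Real.exp_pos _).le, ← Real.exp_add]
        congr 2
        ring
      simp only [hsplit]
      rw [lintegral_const_mul' _ _ ENNReal.ofReal_ne_top]
      calc _ ≤ ENNReal.ofReal A *
            ENNReal.ofReal (Real.exp (r * (a - p.1) + mgfConst * r ^ 2)) := by
            gcongr
            exact lintegral_exp_rayWeight_sample_le hσ hint hmean htail hp hr
        _ = _ := by
            rw [← ENNReal.ofReal_mul (Real.exp_pos _).le, ← Real.exp_add, hrs]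
            congr 2
            push_cast
            ring
    simp only [ENNReal.ofReal_add (Real.exp_pos _).le (Real.exp_pos _).le]
    rw [lintegral_add_left]
    · exact add_le_add (hone s hs rfl) (hone (-s) (by rwa [abs_neg]) (by ring))
    · have : Measurable fun z : ℝ × ℝ => rayWeight z.1 (decide (σ * (p.1 + z.1) ≤ z.2)) :=
        measurable_rayWeight.comp (measurable_fst.prodMk
          (ThresholdLearner.measurable_decide_le (by fun_prop) measurable_snd))
      fun_prop
  · simp [hp]

theorem averagePotential_zero_le {a s e δ : ℝ} {N : ℕ} (hs : s = e / (2 * mgfConst))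
    (hδ : 0 < δ) (hN : 4 * mgfConst * Real.log (4 / δ) ≤ N * e ^ 2) {θ : ℝ}
    (hθ : |θ - a| ≤ 16) : averagePotential a s e N 0 (θ, 0) ≤ δ / 2 := by
  have hK := mgfConst_pos
  have h1 : ((N : ℝ) - (0 : ℕ)) * (mgfConst * s ^ 2) - s * (N * e) ≤ -Real.log (4 / δ) := by
    have : ((N : ℝ) - (0 : ℕ)) * (mgfConst * s ^ 2) - s * (N * e) =
        -((N * e ^ 2) / (4 * mgfConst)) := by
      rw [hs]
      push_cast
      field_simp
      ring
    rw [this, neg_le_neg_iff, le_div_iff₀ (by positivity)]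
    linarith
  have h2 := Real.exp_le_exp.2 h1
  rw [Real.exp_neg, Real.exp_log (by positivity), inv_div] at h2
  simp only [averagePotential, hθ, if_true]
  simp only [Nat.cast_zero, zero_mul, sub_zero, mul_zero, zero_add] at h2 ⊢
  linarith

theorem one_le_averagePotential {a s e : ℝ} {N : ℕ} (hs : 0 < s) (hN : 0 < N) {p : ℝ × ℝ}
    (hp : e ≤ |p.1 + p.2 / N - a|) : 1 ≤ averagePotential a s e N N p := by
  unfold averagePotential
  split_ifs
  · have hN' : (0 : ℝ) < N := by exact_mod_cast hN
    have hd : N * e ≤ |p.2 - N * (a - p.1)| := by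
      have : p.2 - N * (a - p.1) = N * (p.1 + p.2 / N - a) := by field_simp; ring
      rw [this, abs_mul, abs_of_pos hN']
      gcongr
    rw [sub_self, zero_mul, zero_sub]
    rcases le_abs'.1 hd with h | h
    · have : 1 ≤ Real.exp (-s * (p.2 - N * (a - p.1)) + -(s * (N * e))) :=
        Real.one_le_exp (by nlinarith)
      linarith [Real.exp_pos (s * (p.2 - N * (a - p.1)) + -(s * (N * e)))]
    · have : 1 ≤ Real.exp (s * (p.2 - N * (a - p.1)) + -(s * (N * e))) :=
        Real.one_le_exp (by nlinarith)
      linarith [Real.exp_pos (-s * (p.2 - N * (a - p.1)) + -(s * (N * e)))]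
  · exact le_rfl

/-! ### The two-phase learner -/

/-- The learner that searches for `m` rounds and averages afterwards. Its state consists of the
current centre, in units of `σ`, and of the sum of the weights collected so far. -/
noncomputable def meanLearner (σ L b₀ : ℝ) (m : ℕ) : ThresholdLearner (ℝ × ℝ) where
  init := (0, 0)
  threshold t p u := if t < m then σ * p.1 else σ * (p.1 + u)
  update t p τ y :=
    if t < m then
      (p.1 + (if y then 1 else -1) * (shrinkRate L (radius L b₀ t) * radius L b₀ t), 0)
    else (p.1, p.2 + rayWeight (τ / σ - p.1) y)
  measurable_threshold t := by split_ifs <;> fun_prop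
  measurable_update t := by
    split_ifs
    · have : Measurable fun p : (ℝ × ℝ) × ℝ × Bool => if p.2.2 = true then (1 : ℝ) else -1 :=
        (measurable_of_finite fun y : Bool => if y = true then (1 : ℝ) else -1).comp
          (measurable_snd.comp measurable_snd)
      fun_prop
    · have : Measurable fun p : (ℝ × ℝ) × ℝ × Bool => rayWeight (p.2.1 / σ - p.1.1) p.2.2 :=
        measurable_rayWeight.comp ((((measurable_fst.comp measurable_snd).div_const σ).sub
          (measurable_fst.comp measurable_fst)).prodMk (measurable_snd.comp measurable_snd))
      fun_prop

theorem meanLearner_next_of_lt {σ L b₀ : ℝ} {m t : ℕ} (ht : t < m) (p z : ℝ × ℝ) :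
    (meanLearner σ L b₀ m).next t p z =
      (p.1 + (if decide (σ * p.1 ≤ z.2) then 1 else -1) *
        (shrinkRate L (radius L b₀ t) * radius L b₀ t), 0) := by
  simp [ThresholdLearner.next, meanLearner, ht]

theorem meanLearner_next_of_ge {σ L b₀ : ℝ} (hσ : 0 < σ) {m t : ℕ} (ht : ¬ t < m) (p z : ℝ × ℝ) :
    (meanLearner σ L b₀ m).next t p z =
      (p.1, p.2 + rayWeight z.1 (decide (σ * (p.1 + z.1) ≤ z.2))) := by
  have : σ * (p.1 + z.1) / σ - p.1 = z.1 := by field_simp; ring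
  simp [ThresholdLearner.next, meanLearner, ht, this]

/-- The potential of the learner: the search potential, capped at `1` and with room for the
failure probability of the averaging phase, followed by the potential of the averaging phase. -/
noncomputable def meanPotential (a s e δ L b₀ : ℝ) (m N t : ℕ) (p : ℝ × ℝ) : ENNReal :=
  if t < m then
    min 1 (ENNReal.ofReal (((m : ℝ) - t) * Real.exp (-(2 * L)) + δ / 2 +
      searchPotential L (radius L b₀ t) |p.1 - a|))
  else ENNReal.ofReal (averagePotential a s e N (t - m) p)

theorem measurable_meanPotential (a s e δ L b₀ : ℝ) (m N t : ℕ) :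
    Measurable (meanPotential a s e δ L b₀ m N t) := by
  unfold meanPotential
  split_ifs
  · unfold searchPotential
    fun_prop
  · exact (measurable_averagePotential a s e N _).ennreal_ofReal

theorem lintegral_meanPotential_succ_le {D : Measure ℝ} [IsProbabilityMeasure D]
    {σ a s e δ L b₀ : ℝ} {m N : ℕ} (hσ : 0 < σ) (hint : Integrable (fun x : ℝ => x) D)
    (hmean : ∫ x, x ∂D = σ * a)
    (htail : ∀ t : ℝ, 0 ≤ t →
      D {x | t ≤ |x - σ * a|} ≤ ENNReal.ofReal (2 * Real.exp (-t ^ 2 / (2 * σ ^ 2))))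
    (he : 0 < e) (he1 : e < 1) (hs : s = e / (2 * mgfConst)) (hδ : 0 < δ) (hδ1 : δ < 1)
    (hN : 4 * mgfConst * Real.log (4 / δ) ≤ N * e ^ 2) (hL : 128 ≤ L) (hb₀ : 0 < b₀)
    (hm : radius L b₀ m ≤ 16) (hlt : ∀ t < m, 16 < radius L b₀ t) (t : ℕ) (p : ℝ × ℝ) :
    ∫⁻ z, meanPotential a s e δ L b₀ m N (t + 1) ((meanLearner σ L b₀ m).next t p z)
      ∂(cauchyLaw.prod D) ≤ meanPotential a s e δ L b₀ m N t p := by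
  have hK := mgfConst_pos
  have hL0 : 0 ≤ L := by linarith
  by_cases ht : t < m
  · -- The averaging potential right after the search is below the search potential, so that the
    -- last search round is no different from the others.
    have hbound : ∀ q : ℝ, meanPotential a s e δ L b₀ m N (t + 1) (q, 0) ≤
        min 1 (ENNReal.ofReal (((m : ℝ) - (t + 1 : ℕ)) * Real.exp (-(2 * L)) + δ / 2 +
          searchPotential L (radius L b₀ (t + 1)) |q - a|)) := by
      intro q
      unfold meanPotential
      split_ifs with h
      · exact le_rfl
      · have htm : m = t + 1 := by omega
        subst htm
        simp only [Nat.sub_self, sub_self, zero_mul, zero_add]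
        have hE : 0 < searchPotential L (radius L b₀ (t + 1)) |q - a| := Real.exp_pos _
        by_cases hq : |q - a| ≤ 16
        · have := averagePotential_zero_le hs hδ hN hq
          refine le_min ?_ (ENNReal.ofReal_le_ofReal (by linarith))
          rw [ENNReal.ofReal_le_one]
          linarith
        · have : 1 ≤ searchPotential L (radius L b₀ (t + 1)) |q - a| := by
            refine Real.one_le_exp (mul_nonneg (by positivity) ?_)
            rw [sub_nonneg, one_le_div (radius_pos hL0 hb₀ _)]
            linarith
          simp only [averagePotential, hq, if_false, ENNReal.ofReal_one]
          refine le_min le_rfl ?_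
          rw [ENNReal.one_le_ofReal]
          linarith
    have hrw : meanPotential a s e δ L b₀ m N t p =
        min 1 (ENNReal.ofReal (((m : ℝ) - t) * Real.exp (-(2 * L)) + δ / 2 +
          searchPotential L (radius L b₀ t) |p.1 - a|)) := by
      simp [meanPotential, ht]
    rw [hrw]
    have htm : ((t + 1 : ℕ) : ℝ) ≤ m := by exact_mod_cast ht
    set c := ((m : ℝ) - (t + 1 : ℕ)) * Real.exp (-(2 * L)) + δ / 2 with hc
    have hc0 : 0 ≤ c :=
      add_nonneg (mul_nonneg (sub_nonneg.2 htm) (Real.exp_pos _).le) (by linarith)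
    refine le_min ?_ ?_
    · calc _ ≤ ∫⁻ _, 1 ∂(cauchyLaw.prod D) := by
            refine lintegral_mono fun z => ?_
            rw [meanLearner_next_of_lt ht]
            exact (hbound _).trans (min_le_left _ _)
        _ = 1 := by simp
    · set F : ℝ → ENNReal := fun x => min 1 (ENNReal.ofReal (c +
        searchPotential L (radius L b₀ t * (1 - shrinkRate L (radius L b₀ t) / 2))
          |p.1 + (if decide (σ * p.1 ≤ x) then 1 else -1) *
            (shrinkRate L (radius L b₀ t) * radius L b₀ t) - a|)) with hF
      have hFm : Measurable F := by
        have : Measurable fun x : ℝ => if decide (σ * p.1 ≤ x) = true then (1 : ℝ) else -1 :=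
          (measurable_of_finite fun y : Bool => if y = true then (1 : ℝ) else -1).comp
            (ThresholdLearner.measurable_decide_le measurable_const measurable_id)
        unfold F searchPotential
        fun_prop
      calc _ ≤ ∫⁻ z, F z.2 ∂(cauchyLaw.prod D) := by
            refine lintegral_mono fun z => ?_
            rw [meanLearner_next_of_lt ht]
            exact hbound _
        _ = ∫⁻ x, F x ∂D := measurePreserving_snd.lintegral_comp hFm
        _ ≤ _ := lintegral_searchPotential_le hσ htail hL (hlt t ht).le hc0
        _ = _ := by
            congr 2
            rw [hc]
            push_cast
            ring
  · have hrw : ∀ q, meanPotential a s e δ L b₀ m N (t + 1) q =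
        ENNReal.ofReal (averagePotential a s e N (t - m + 1) q) := by
      intro q
      rw [meanPotential, if_neg (by omega), show t + 1 - m = t - m + 1 by omega]
    simp only [hrw, meanLearner_next_of_ge hσ ht]
    rw [meanPotential, if_neg ht]
    refine lintegral_averagePotential_succ_le hσ hint hmean htail ?_ e N (t - m) p
    rw [hs, abs_of_pos (by positivity), div_le_div_iff₀ (by positivity) (by positivity)]
    have h1 : (1 : ℝ) ≤ Real.exp 129 := Real.one_le_exp (by norm_num)
    have h2 : 5120 ≤ mgfConst := by unfold mgfConst; linarith
    nlinarith [Real.pi_lt_four, Real.pi_pos]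

/-- The search phase fails with probability at most `δ / 2`, since there are only `O(L)` rounds with
a loss of `exp (-2 L)` each. -/
theorem search_loss_le {L lam' δ : ℝ} {m : ℕ} (hlam : 1 ≤ lam') (hδ : 0 < δ) (hδ1 : δ < 1)
    (hL : L = 128 + Real.log lam' + Real.log (1 / δ))
    (hm : (m : ℝ) ≤ 512 * Real.log (32 * lam' / 16) + L + 1) :
    (m : ℝ) ≤ 514 * L ∧ (m + 1) * Real.exp (-(2 * L)) ≤ δ / 2 := by
  have hl0 : 0 ≤ Real.log lam' := Real.log_nonneg hlam
  have hd0 : 0 ≤ Real.log (1 / δ) := Real.log_nonneg (by rw [le_div_iff₀ hδ]; linarith)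
  have h1 : Real.log (32 * lam' / 16) ≤ 1 + Real.log lam' := by
    rw [show 32 * lam' / 16 = 2 * lam' by ring, Real.log_mul (by norm_num) (by linarith)]
    linarith [Real.log_two_lt_d9]
  have hm' : (m : ℝ) + 1 ≤ 514 * L := by linarith
  refine ⟨by linarith, ?_⟩
  have h2 : Real.exp (-L) ≤ δ * Real.exp (-128) := by
    calc Real.exp (-L) ≤ Real.exp (Real.log δ + -128) := by
          gcongr
          rw [hL, one_div, Real.log_inv] at *
          linarith
      _ = _ := by rw [Real.exp_add, Real.exp_log hδ]
  have h3 : L * Real.exp (-L) ≤ 1 := by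
    rw [Real.exp_neg, ← div_eq_mul_inv, div_le_one (Real.exp_pos _)]
    linarith [Real.add_one_le_exp L]
  have h4 : Real.exp (-128) ≤ 1 / 1028 := by
    rw [Real.exp_neg, inv_le_comm₀ (Real.exp_pos _) (by norm_num)]
    have := Real.quadratic_le_exp_of_nonneg (x := 128) (by norm_num)
    linarith
  calc (m + 1) * Real.exp (-(2 * L)) ≤ 514 * L * Real.exp (-(2 * L)) := by gcongr
    _ = 514 * (L * Real.exp (-L)) * Real.exp (-L) := by
        rw [show -(2 * L) = -L + -L by ring, Real.exp_add]; ring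
    _ ≤ 514 * 1 * (δ * Real.exp (-128)) := by gcongr
    _ ≤ 514 * 1 * (δ * (1 / 1028)) := by gcongr
    _ = δ / 2 := by ring

theorem exists_estimator {lam σ ε δ : ℝ} (hε : 0 < ε) (hεσ : ε < σ) (hσl : σ ≤ lam) (hδ : 0 < δ)
    (hδ1 : δ < 1) :
    ∃ (n : ℕ) (A : OneBitMeanEstimator n),
      (n : ℝ) ≤ 514 * (128 + Real.log (lam / σ) + Real.log (1 / δ)) +
        4 * mgfConst * (σ ^ 2 / ε ^ 2 * Real.log (4 / δ)) + 1 ∧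
      A.UsesIntervalQueries ∧ A.IsPAC ε δ (subGaussianFamily lam σ) := by
  have hσ : 0 < σ := hε.trans hεσ
  have hK := mgfConst_pos
  set e := ε / σ with he
  have he0 : 0 < e := by positivity
  have he1 : e < 1 := (div_lt_one hσ).2 hεσ
  set lam' := lam / σ with hlam'
  have hl1 : 1 ≤ lam' := (one_le_div hσ).2 hσl
  set L := 128 + Real.log lam' + Real.log (1 / δ) with hL
  have hl0 : 0 ≤ Real.log lam' := Real.log_nonneg hl1
  have hd0 : 0 ≤ Real.log (1 / δ) := Real.log_nonneg (by rw [le_div_iff₀ hδ]; linarith)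
  have hd4 : 0 < Real.log (4 / δ) := Real.log_pos (by rw [lt_div_iff₀ hδ]; linarith)
  have hL128 : 128 ≤ L := by linarith
  have hL0 : 0 ≤ L := by linarith
  set b₀ := 32 * lam' with hb₀
  have hb16 : 16 < b₀ := by linarith
  have hb0 : 0 < b₀ := by linarith
  obtain ⟨m, hm, hlt, hmle⟩ := exists_radius_le hL0 hb16
  obtain ⟨hm514, hloss⟩ := search_loss_le hl1 hδ hδ1 hL hmle
  set R := 4 * mgfConst * Real.log (4 / δ) / e ^ 2 with hR
  have hR0 : 0 < R := by positivity
  set N := ⌈R⌉₊ with hNdef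
  have hN0 : 0 < N := Nat.ceil_pos.2 hR0
  have hN : 4 * mgfConst * Real.log (4 / δ) ≤ N * e ^ 2 :=
    (div_le_iff₀ (by positivity)).1 (Nat.le_ceil R)
  have hout : Measurable fun p : ℝ × ℝ => σ * (p.1 + p.2 / N) := by fun_prop
  refine ⟨m + N, (meanLearner σ L b₀ m).toEstimator (m + N) cauchyLaw _ hout, ?_,
    (meanLearner σ L b₀ m).usesIntervalQueries_toEstimator _ _ _ hout, ?_⟩
  · have h1 : (N : ℝ) ≤ R + 1 := (Nat.ceil_lt_add_one hR0.le).le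
    have h2 : R = 4 * mgfConst * (σ ^ 2 / ε ^ 2 * Real.log (4 / δ)) := by
      rw [hR, he]
      field_simp
    push_cast
    linarith
  · rintro D ⟨hD, hint, hmean, htail⟩
    set a := (∫ x, x ∂D) / σ with ha
    have hμ : ∫ x, x ∂D = σ * a := by rw [ha]; field_simp
    rw [hμ] at htail hmean ⊢
    have hal : |a| ≤ lam' := by
      rw [abs_mul, abs_of_pos hσ] at hmean
      rw [hlam', le_div_iff₀ hσ]
      linarith
    refine (meanLearner σ L b₀ m).le_measure_output_toEstimator (m + N) cauchyLaw _ hout D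
      (meanPotential a (e / (2 * mgfConst)) e δ L b₀ m N)
      (measurable_meanPotential _ _ _ _ _ _ _ _)
      (fun t _ p => lintegral_meanPotential_succ_le hσ hint hμ htail he0 he1 rfl hδ hδ1 hN hL128
        hb0 hm hlt t p) ?_ ?_ hδ.le
    · intro p hp
      rw [meanPotential, if_neg (by omega), Nat.add_sub_cancel_left, ENNReal.one_le_ofReal]
      refine one_le_averagePotential (by positivity) hN0 ?_
      rw [← mul_sub, abs_mul, abs_of_pos hσ] at hp
      rw [he, div_le_iff₀ hσ]
      linarith
    · have hm0 : 0 < m := Nat.pos_of_ne_zero fun h => by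
        rw [h] at hm
        exact absurd hm (not_le.2 hb16)
      rw [meanPotential, if_pos hm0]
      refine (min_le_right _ _).trans (ENNReal.ofReal_le_ofReal ?_)
      have h1 : searchPotential L (radius L b₀ 0) |(meanLearner σ L b₀ m).init.1 - a| ≤
          Real.exp (-(2 * L)) := by
        unfold searchPotential
        rw [Real.exp_le_exp]
        have h2 : |(meanLearner σ L b₀ m).init.1 - a| / radius L b₀ 0 ≤ 1 / 32 := by
          simp only [meanLearner, radius, zero_sub, abs_neg]
          rw [div_le_iff₀ hb0]
          linarith
        nlinarith [mul_le_mul_of_nonneg_left h2 hL0]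
      push_cast
      linarith

/-! ### Guessing when the failure probability is large -/

/-- The learner that asks for the random threshold it is given and remembers it. -/
noncomputable def guessLearner : ThresholdLearner ℝ where
  init := 0
  threshold _ _ u := u
  update _ _ τ _ := τ
  measurable_threshold _ := measurable_snd
  measurable_update _ := measurable_fst.comp measurable_snd

/-- The uniform law on `{-2ε, 0, 2ε}`. -/
noncomputable def guessLaw (ε : ℝ) : Measure ℝ :=
  (3⁻¹ : ENNReal) • (Measure.dirac (-(2 * ε)) + Measure.dirac 0 + Measure.dirac (2 * ε))

instance isProbabilityMeasure_guessLaw (ε : ℝ) : IsProbabilityMeasure (guessLaw ε) := by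
  constructor
  simp only [guessLaw, Measure.smul_apply, Measure.add_apply, measure_univ, smul_eq_mul]
  rw [show (1 : ENNReal) + 1 + 1 = 3 by norm_num]
  exact ENNReal.inv_mul_cancel (by norm_num) (by norm_num)

/-- If all admissible means lie in `[-3ε, 3ε]`, then one of three guesses is correct. The guess has
to be random, since a fixed one would fail with certainty on some distribution, and the threshold of
a single query makes it part of the transcript. -/
theorem exists_estimator_of_le {lam σ ε δ : ℝ} (hlam : lam ≤ 3 * ε) (hδ : 2 / 3 ≤ δ) :
    ∃ A : OneBitMeanEstimator 1,
      A.UsesIntervalQueries ∧ A.IsPAC ε δ (subGaussianFamily lam σ) := by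
  refine ⟨guessLearner.toEstimator 1 (guessLaw ε) id measurable_id,
    guessLearner.usesIntervalQueries_toEstimator _ _ _ _, ?_⟩
  rintro D ⟨hD, -, hmean, -⟩
  set a := ∫ x, x ∂D
  have hBm : MeasurableSet {u : ℝ | ε < |u - a|} :=
    measurableSet_lt measurable_const (by fun_prop)
  have hB : guessLaw ε {u | ε < |u - a|} ≤ ENNReal.ofReal δ := by
    have h2 : (3⁻¹ : ENNReal) * 2 ≤ ENNReal.ofReal δ := by
      refine le_trans (le_of_eq ?_) (ENNReal.ofReal_le_ofReal hδ)
      rw [ENNReal.ofReal_div_of_pos (by norm_num), ENNReal.div_eq_inv_mul]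
      simp
    refine le_trans ?_ h2
    simp only [guessLaw, Measure.smul_apply, Measure.add_apply, smul_eq_mul,
      Measure.dirac_apply' _ hBm]
    gcongr
    have hle : ∀ u : ℝ, {u : ℝ | ε < |u - a|}.indicator (1 : ℝ → ENNReal) u ≤ 1 := fun u =>
      Set.indicator_le_self' (fun _ _ => zero_le_one) u
    have hzero : ∀ u : ℝ, |u - a| ≤ ε →
        {u : ℝ | ε < |u - a|}.indicator (1 : ℝ → ENNReal) u = 0 := fun u hu =>
      Set.indicator_of_notMem (by simpa using hu) _
    have ha := abs_le.1 hmean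
    rcases le_or_gt a (-ε) with h1 | h1
    · rw [hzero (-(2 * ε)) (abs_le.2 ⟨by linarith, by linarith⟩), zero_add]
      exact (add_le_add (hle _) (hle _)).trans_eq one_add_one_eq_two
    rcases le_or_gt a ε with h3 | h3
    · rw [hzero 0 (abs_le.2 ⟨by linarith, by linarith⟩), add_zero]
      exact (add_le_add (hle _) (hle _)).trans_eq one_add_one_eq_two
    · rw [hzero (2 * ε) (abs_le.2 ⟨by linarith, by linarith⟩), add_zero]
      exact (add_le_add (hle _) (hle _)).trans_eq one_add_one_eq_two
  refine guessLearner.le_measure_output_toEstimator 1 (guessLaw ε) id measurable_id D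
    (fun t x => if t = 0 then ENNReal.ofReal δ else {u | ε < |u - a|}.indicator 1 x) ?_ ?_ ?_ ?_
    (by linarith)
  · intro t
    split_ifs
    · exact measurable_const
    · exact measurable_one.indicator hBm
  · intro t ht x
    obtain rfl : t = 0 := by omega
    simp only [zero_add, one_ne_zero, if_false, if_true, ThresholdLearner.next, guessLearner]
    have hfst := (measurePreserving_fst (μ := guessLaw ε) (ν := D)).lintegral_comp
      ((measurable_one (α := ENNReal)).indicator hBm)
    exact hfst.trans_le ((lintegral_indicator_one hBm).trans_le hB)
  · intro x hx
    have hx' : x ∈ {u : ℝ | ε < |u - a|} := hx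
    simp [Set.indicator_of_mem hx']
  · simp

/-! ### The sample budget -/

theorem one_le_logStar {x : ℝ} (hx : 1 < x) : 1 ≤ logStar x := by
  by_contra! h
  have h0 : logStar x = 0 := by omega
  have : logStar x ∈ {k : ℕ | Real.log^[k] x ≤ 1} := Nat.sInf_mem (exists_iterate_log_le_one x)
  rw [h0] at this
  exact absurd hx (not_lt.2 this)

theorem le_exp_one_of_logStar_eq_one {x : ℝ} (hx : 0 < x) (h : logStar x = 1) :
    x ≤ Real.exp 1 := by
  have : logStar x ∈ {k : ℕ | Real.log^[k] x ≤ 1} := Nat.sInf_mem (exists_iterate_log_le_one x)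
  rw [h] at this
  exact (Real.log_le_iff_le_exp hx).1 this

theorem log_inv_le_budget {x δ : ℝ} {l : ℕ} (hx : 1 < x) (hl : 1 ≤ l) (hδ : 0 < δ) (hδ1 : δ < 1) :
    Real.log (1 / δ) ≤ x ^ 2 * (l : ℝ) ^ 3 * Real.log (l / δ) := by
  have hl' : (1 : ℝ) ≤ l := by exact_mod_cast hl
  have h0 : 0 ≤ Real.log (1 / δ) := Real.log_nonneg (by rw [le_div_iff₀ hδ]; linarith)
  have h1 : Real.log (1 / δ) ≤ Real.log (l / δ) := Real.log_le_log (by positivity) (by gcongr)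
  have h2 : 1 ≤ x ^ 2 * (l : ℝ) ^ 3 :=
    one_le_mul_of_one_le_of_one_le (one_le_pow₀ hx.le) (one_le_pow₀ hl')
  nlinarith

theorem log_two_le_budget {x δ : ℝ} {l : ℕ} (hx : 1 < x) (hl : 2 ≤ l) (hδ : 0 < δ) (hδ1 : δ < 1) :
    x ^ 2 * Real.log (4 / δ) ≤ 2 * (x ^ 2 * (l : ℝ) ^ 3 * Real.log (l / δ)) ∧
      Real.log 2 ≤ x ^ 2 * (l : ℝ) ^ 3 * Real.log (l / δ) := by
  have hl' : (2 : ℝ) ≤ l := by exact_mod_cast hl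
  have h1 : Real.log (2 / δ) ≤ Real.log (l / δ) := Real.log_le_log (by positivity) (by gcongr)
  have hd : Real.log δ < 0 := Real.log_neg hδ hδ1
  have h2 : Real.log (2 / δ) = Real.log 2 - Real.log δ := Real.log_div (by norm_num) hδ.ne'
  have h4 : Real.log (4 / δ) = 2 * Real.log 2 - Real.log δ := by
    rw [Real.log_div (by norm_num) hδ.ne', show (4 : ℝ) = 2 ^ 2 by norm_num, Real.log_pow]
    norm_num
  have hlog2 : 0 < Real.log 2 := Real.log_pos (by norm_num)
  have hl3 : (1 : ℝ) ≤ (l : ℝ) ^ 3 := one_le_pow₀ (by linarith)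
  have hx2 : 1 ≤ x ^ 2 := one_le_pow₀ hx.le
  have h5 : Real.log (l / δ) ≤ (l : ℝ) ^ 3 * Real.log (l / δ) :=
    le_mul_of_one_le_left (by linarith) hl3
  constructor <;> nlinarith

theorem theorem5 :
    ∃ C : ℝ, 0 < C ∧
      ∀ lam σ ε δ : ℝ, 0 < ε → ε < σ → σ ≤ lam → 0 < δ → δ < 1 →
        ∃ (n : ℕ) (A : OneBitMeanEstimator n),
          n ≤ ⌈C * (σ ^ 2 / ε ^ 2 * (logStar (σ / ε) : ℝ) ^ 3 *
                  Real.log ((logStar (σ / ε) : ℝ) / δ)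
                + Real.log (lam / σ))⌉₊ ∧
          A.UsesIntervalQueries ∧
          A.IsPAC ε δ (subGaussianFamily lam σ) := by
  have hK := mgfConst_pos
  refine ⟨514 * 2562 + 964 * mgfConst + 20, by positivity, ?_⟩
  intro lam σ ε δ hε hεσ hσl hδ hδ1
  have hσ : 0 < σ := hε.trans hεσ
  have hx : 1 < σ / ε := (one_lt_div hε).2 hεσ
  have hl1 := one_le_logStar hx
  set l := logStar (σ / ε) with hl
  have hll : 0 ≤ Real.log (lam / σ) := Real.log_nonneg ((one_le_div hσ).2 hσl)
  have hd0 : 0 < Real.log (1 / δ) := Real.log_pos (by rw [lt_div_iff₀ hδ]; linarith)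
  rw [← div_pow]
  set B := (σ / ε) ^ 2 * (l : ℝ) ^ 3 * Real.log (l / δ) with hB
  have hdB : Real.log (1 / δ) ≤ B := log_inv_le_budget hx hl1 hδ hδ1
  have hl_eq : l = 1 ∨ 2 ≤ l := by omega
  rcases lt_or_ge (B + Real.log (lam / σ)) (1 / 20) with hsmall | hlarge
  · -- The budget is less than a constant only if `σ / ε` and `lam / σ` are bounded and `δ` is close
    -- to `1`. It may then allow no more than a single sample.
    have hleq : l = 1 := by
      refine hl_eq.resolve_right fun h => ?_
      linarith [(log_two_le_budget hx h hδ hδ1).2, Real.log_two_gt_d9]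
    have hxe := le_exp_one_of_logStar_eq_one (by positivity) hleq
    have h1 : lam / σ ≤ 20 / 19 := by
      have h2 : lam / σ ≤ Real.exp (1 / 20) :=
        (Real.log_le_iff_le_exp (div_pos (by linarith) hσ)).1 (by linarith)
      have h3 : Real.exp (1 / 20) ≤ 20 / 19 := by
        have := Real.add_one_le_exp (-(1 / 20) : ℝ)
        rw [Real.exp_neg] at this
        rw [← inv_inv (Real.exp (1 / 20)), inv_le_comm₀ (by positivity) (by norm_num)]
        linarith
      linarith
    have hδ23 : 2 / 3 ≤ δ := by
      have := Real.one_sub_inv_le_log_of_pos (x := 1 / δ) (by positivity)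
      rw [one_div, inv_inv, ← one_div] at this
      linarith
    have hlam : lam ≤ 3 * ε := by
      rw [div_le_iff₀ hε] at hxe
      rw [div_le_iff₀ hσ] at h1
      have := Real.exp_one_lt_d9
      nlinarith
    obtain ⟨A, hA⟩ := exists_estimator_of_le (σ := σ) hlam hδ23
    refine ⟨1, A, ?_, hA⟩
    rw [Nat.one_le_ceil_iff]
    exact mul_pos (by positivity) (by linarith)
  · obtain ⟨n, A, hn, hA⟩ := exists_estimator hε hεσ hσl hδ hδ1
    refine ⟨n, A, ?_, hA⟩
    rw [← div_pow] at hn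
    have h4 : (σ / ε) ^ 2 * Real.log (4 / δ) ≤ 241 * (B + Real.log (lam / σ)) := by
      rcases hl_eq with h | h
      · have hxe := le_exp_one_of_logStar_eq_one (by positivity) h
        have hx2 : (σ / ε) ^ 2 ≤ 8 := by
          have := Real.exp_one_lt_d9
          nlinarith
        have hlog4 : Real.log 4 ≤ 3 / 2 := by
          rw [show (4 : ℝ) = 2 ^ 2 by norm_num, Real.log_pow]
          have := Real.log_two_lt_d9
          push_cast
          linarith
        have hB1 : B = (σ / ε) ^ 2 * Real.log (1 / δ) := by rw [hB, h]; simp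
        rw [Real.log_div (by norm_num) hδ.ne']
        rw [one_div, Real.log_inv] at hB1
        have : (σ / ε) ^ 2 * Real.log 4 ≤ 8 * (3 / 2) :=
          mul_le_mul hx2 hlog4 (Real.log_nonneg (by norm_num)) (by norm_num)
        nlinarith
      · linarith [(log_two_le_budget hx h hδ hδ1).1]
    have hcast : (n : ℝ) ≤
        (514 * 2562 + 964 * mgfConst + 20) * (B + Real.log (lam / σ)) := by
      nlinarith [mul_le_mul_of_nonneg_left h4 hK.le]
    exact_mod_cast hcast.trans (Nat.le_ceil _)
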